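/- There is a numerical constant $c>0$ with the following property. Let $\mathcal H$ be a finite-dimensional complex Hilbert space and let $\eta$ be a faithful state on $\mathcal H$, i.e. a positive definite operator with $\operatorname{Tr}\eta=1$, with spectral decomposition $\eta=\sum_i\mu_i p_i$, where the $\mu_i$ are the distinct eigenvalues of $\eta$ and the $p_i$ the associated spectral projections. Put \[ C_\eta = c\,\dim\mathcal H\,\frac{\log 2-\log\inf\mathrm{sp}\,\eta}{(\inf\mathrm{sp}\,\eta)^4}>0 . \] Then there is a constant $D_\eta>0$, depending only on $\eta$, such that for all operators $D_1,D_2$ on $\mathcal H$ (not necessarily self-adjoint) with $\operatorname{Tr}D_1=\operatorname{Tr}D_2=0$ and $\|D_1\|\le D_\eta$, $\|D_2\|\le D_\eta$ (operator norm), $\log(\eta+D_1)$ and $\log(\eta+D_2)$ are well defined by the holomorphic functional calculus of the principal logarithm (over a circle around the spectrum whose closed disc avoids $(-\infty,0]$), and the relative entropy $S(\rho|\nu)=\operatorname{Tr}\big(\rho(\log\rho-\log\nu)\big)$ satisfies \[ \big|S(\eta+D_1|\eta+D_2)-F_\eta(D_1-D_2)\big|\le C_\eta\,(\|D_1\|+\|D_2\|)^3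 , \] where $F_\eta(A)=F_\eta(A,A)$ and \[ F_\eta(A,B)=\sum_i\operatorname{Tr}(A p_i B p_i)\,\frac1{2\mu_i}+\sum_{i<j}\operatorname{Tr}(A p_j B p_i)\,\frac{\log\mu_i-\log\mu_j}{\mu_i-\mu_j}. \] -/

import Mathlib

open scoped BigOperators

noncomputable section

namespace EntropyPerturbation

variable {H : Type*} [NormedAddCommGroup H] [InnerProductSpace ℂ H]

/-- The trace of an operator. -/
def tr (A : H →L[ℂ] H) : ℂ := LinearMap.trace ℂ H (A : H →ₗ[ℂ] H)

/-- A faithful state: a positive definite self-adjoint operator of trace one. -/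
structure IsFaithfulState [CompleteSpace H] (η : H →L[ℂ] H) : Prop where
  selfAdjoint : IsSelfAdjoint η
  posDef : ∀ x : H, x ≠ 0 → 0 < (inner ℂ x (η x)).re
  trace_one : tr η = 1

/-- `η = ∑ i, μ i • p i`, where `μ` lists the distinct eigenvalues of `η` and the `p i` are the
associated (nonzero, orthogonal) spectral projections. -/
structure IsSpectralDecomposition [CompleteSpace H] (η : H →L[ℂ] H) {n : ℕ}
    (μ : Fin n → ℝ) (p : Fin n → H →L[ℂ] H) : Prop where
  injective : Function.Injective μ
  projection : ∀ i, IsStarProjection (p i)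
  ne_zero : ∀ i, p i ≠ 0
  orthogonal : ∀ i j, i ≠ j → p i * p j = 0
  sum_eq_one : ∑ i, p i = 1
  eq_sum : η = ∑ i, (μ i : ℂ) • p i

/-- The infimum of the spectrum (meant for self-adjoint operators, whose spectrum is real). -/
def infSp (η : H →L[ℂ] H) : ℝ := sInf (spectrum ℝ η)

/-- The circle of centre `c` and radius `r` is an admissible contour for the holomorphic functional
calculus of the principal logarithm at `M`: it encircles the spectrum of `M`, and the closed disc
that it bounds lies in the domain `ℂ \ (-∞, 0]` of the logarithm. -/
def IsLogContour (M : H →L[ℂ] H) (c : ℂ) (r : ℝ) : Prop :=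
  0 < r ∧ Metric.closedBall c r ⊆ Complex.slitPlane ∧ spectrum ℂ M ⊆ Metric.ball c r

/-- There is an admissible circle. This holds, in finite dimension, whenever the spectrum of `M`
lies in the open right half-plane. -/
def HasLog (M : H →L[ℂ] H) : Prop := ∃ γ : ℂ × ℝ, IsLogContour M γ.1 γ.2

open Classical in
/-- The logarithm of a (not necessarily self-adjoint) operator, by the holomorphic (Dunford-Taylor)
functional calculus: `log M = (2πi)⁻¹ ∮ log ζ (ζ - M)⁻¹ dζ` over an admissible circle. By Cauchy's
theorem the value does not depend on which admissible circle is taken. -/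
def opLog (M : H →L[ℂ] H) : H →L[ℂ] H :=
  if h : HasLog M then
    (2 * (Real.pi : ℂ) * Complex.I)⁻¹ •
      ∮ ζ in C(h.choose.1, h.choose.2), Complex.log ζ • resolvent M ζ
  else 0

/-- The relative entropy `S(ρ|ν) = Tr (ρ (log ρ - log ν))`. -/
def relEntropy (ρ ν : H →L[ℂ] H) : ℂ := tr (ρ * (opLog ρ - opLog ν))

/-- The bilinear form `F_η(A, B)`, written with the spectral data of `η`. -/
def bilinF {n : ℕ} (μ : Fin n → ℝ) (p : Fin n → H →L[ℂ] H) (A B : H →L[ℂ] H) : ℂ :=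
  ∑ i, tr (A * p i * B * p i) * ((1 / (2 * μ i) : ℝ) : ℂ) +
    ∑ i, ∑ j ∈ Finset.Ioi i,
      tr (A * p j * B * p i) * (((Real.log (μ i) - Real.log (μ j)) / (μ i - μ j) : ℝ) : ℂ)

/-- The quadratic form `F_η(A) = F_η(A, A)`. -/
def quadF {n : ℕ} (μ : Fin n → ℝ) (p : Fin n → H →L[ℂ] H) (A : H →L[ℂ] H) : ℂ :=
  bilinF μ p A A

/-- `C_η = c · dim H · (log 2 - log inf sp η) / (inf sp η)⁴`. -/
def constC (c : ℝ) (η : H →L[ℂ] H) : ℝ :=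
  c * (Module.finrank ℂ H : ℝ) * ((Real.log 2 - Real.log (infSp η)) / infSp η ^ 4)

end EntropyPerturbation

end

/-!
The logarithm is integrated over the segment from `1` to its argument instead of over a circle:
`log M = ∫₀¹ (M - 1) V_M(t) dt` with `V_M(t) = (1 + t (M - 1))⁻¹`. For `ρ`, `ν` with equal traces
and `D = ρ - ν`, two uses of the resolvent identity give

`S(ρ|ν) = ∫₀¹ tr (ρ V_ρ² D) dt + ∫₀¹ tr (W_ρ D V_ν D) dt`, where `W_ρ = t ρ V_ρ²`.

Since `ρ V_ρ²` is the derivative of `t ρ V_ρ`, the first integral is `tr D = 0`, so the second one,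
which is quadratic in `D`, is exactly the relative entropy. With `η` in place of both `ρ` and `ν` it
becomes `½ ∫₀¹ tr (V_η D V_η D) dt` by an integration by parts, and this is `F_η(D)` in the spectral
decomposition of `η`. Replacing `ρ`, `ν` by `η` changes `W_ρ`, `V_ν` to first order only, hence the
integral to third order.
-/

noncomputable section

namespace EntropyPerturbation

open Set Metric Filter Topology

section DunfordIntegral

theorem tendsto_circleIntegral_sub_inv_smul {E : Type*} [NormedAddCommGroup E] [NormedSpace ℂ E]
    {g : ℂ → E} (hg : Tendsto g (Bornology.cobounded ℂ) (𝓝 0)) (c : ℂ) :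
    Tendsto (fun R : ℝ => ∮ ζ in C(c, R), (ζ - c)⁻¹ • g ζ) atTop (𝓝 0) := by
  rw [Metric.tendsto_nhds]
  intro ε hε
  have hsmall : ∀ᶠ z in Bornology.cobounded ℂ, ‖g z‖ ≤ ε / (4 * Real.pi) := by
    filter_upwards [hg.norm.eventually_lt_const
      (norm_zero.trans_lt (by positivity : 0 < ε / (4 * Real.pi)))] with z hz using hz.le
  obtain ⟨R₀, -, hR₀⟩ := (hasBasis_cobounded_compl_closedBall c).eventually_iff.mp hsmall
  filter_upwards [eventually_gt_atTop R₀, eventually_gt_atTop 0] with R hR hR0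
  rw [dist_zero_right]
  calc ‖∮ ζ in C(c, R), (ζ - c)⁻¹ • g ζ‖
      ≤ 2 * Real.pi * R * (R⁻¹ * (ε / (4 * Real.pi))) := by
        refine circleIntegral.norm_integral_le_of_norm_le_const hR0.le fun z hz => ?_
        have hzR : ‖z - c‖ = R := by rwa [← dist_eq_norm]
        rw [norm_smul, norm_inv, hzR]
        gcongr
        exact hR₀ fun hzb => (hR.trans_eq hz.symm).not_ge hzb
    _ = ε / 2 := by field_simp; norm_num
    _ < ε := half_lt_self hε

theorem circleIntegral_intervalIntegral_swap {E : Type*} [NormedAddCommGroup E] [NormedSpace ℂ E]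
    {f : ℂ → ℝ → E} {c : ℂ} {r x y : ℝ} (hr : 0 ≤ r) (hxy : x ≤ y)
    (hf : ContinuousOn f.uncurry (sphere c r ×ˢ Icc x y)) :
    ∮ ζ in C(c, r), ∫ t in x..y, f ζ t = ∫ t in x..y, ∮ ζ in C(c, r), f ζ t := by
  have hderiv : Continuous fun u : ℝ × ℝ => deriv (circleMap c r) u.1 := by
    simp only [deriv_circleMap]
    exact ((continuous_circleMap 0 r).comp continuous_fst).mul continuous_const
  have hcont : ContinuousOn (fun u : ℝ × ℝ => deriv (circleMap c r) u.1 • f (circleMap c r u.1) u.2)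
      (Icc 0 (2 * Real.pi) ×ˢ Icc x y) :=
    hderiv.continuousOn.smul <| hf.comp (f := fun u : ℝ × ℝ => (circleMap c r u.1, u.2))
      (((continuous_circleMap c r).comp continuous_fst).prodMk continuous_snd).continuousOn
      fun u hu => ⟨circleMap_mem_sphere c hr u.1, hu.2⟩
  simp only [circleIntegral, ← intervalIntegral.integral_smul]
  refine MeasureTheory.intervalIntegral_intervalIntegral_swap ?_
  rw [uIoc_of_le Real.two_pi_pos.le, uIoc_of_le hxy]
  exact (hcont.integrableOn_compact (isCompact_Icc.prod isCompact_Icc)).mono_set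
    (prod_mono Ioc_subset_Icc_self Ioc_subset_Icc_self)

variable {A : Type*} [NormedRing A] [NormedAlgebra ℂ A] {a : A} {c : ℂ} {r : ℝ}

theorem mul_resolvent_eq_smul_sub_one {z : ℂ} (hz : z ∈ resolventSet ℂ a) :
    a * resolvent a z = z • resolvent a z - 1 := by
  have h : (z • (1 : A) - a) * resolvent a z = 1 := by
    rw [← Algebra.algebraMap_eq_smul_one]
    exact Ring.mul_inverse_cancel _ hz
  rw [← h, sub_mul, smul_one_mul, sub_sub_cancel]

theorem compl_ball_subset_resolventSet (h : spectrum ℂ a ⊆ ball c r) :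
    (ball c r)ᶜ ⊆ resolventSet ℂ a :=
  compl_subset_comm.mp h

theorem sphere_subset_resolventSet (h : spectrum ℂ a ⊆ ball c r) :
    sphere c r ⊆ resolventSet ℂ a :=
  sphere_disjoint_ball.subset_compl_right.trans
    (compl_ball_subset_resolventSet h)

variable [CompleteSpace A]

theorem differentiableAt_resolvent {z : ℂ} (hz : z ∈ resolventSet ℂ a) :
    DifferentiableAt ℂ (resolvent a) z :=
  (spectrum.hasDerivAt_resolvent_const_left hz).differentiableAt

theorem continuousOn_resolvent_sphere (h : spectrum ℂ a ⊆ ball c r) :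
    ContinuousOn (resolvent a) (sphere c r) := fun _ hz =>
  (differentiableAt_resolvent
    (sphere_subset_resolventSet h hz)).continuousAt.continuousWithinAt

theorem circleIntegral_resolvent_eq_of_le (hr : 0 < r) (h : spectrum ℂ a ⊆ ball c r) {R : ℝ}
    (hR : r ≤ R) : ∮ ζ in C(c, r), resolvent a ζ = ∮ ζ in C(c, R), resolvent a ζ := by
  have hdiff : ∀ z, z ∉ ball c r → DifferentiableAt ℂ (resolvent a) z := fun z hz =>
    differentiableAt_resolvent (compl_ball_subset_resolventSet h hz)
  refine (Complex.circleIntegral_eq_of_differentiable_on_annulus_off_countable hr hR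
    countable_empty (fun z hz => ?_) fun z hz => ?_).symm
  · exact (hdiff z hz.2).continuousAt.continuousWithinAt
  · exact hdiff z fun hzb => hz.1.2 (ball_subset_closedBall hzb)

theorem circleIntegral_resolvent_eq_add (hr : 0 < r) (h : spectrum ℂ a ⊆ ball c r) :
    ∮ ζ in C(c, r), resolvent a ζ = (2 * (Real.pi : ℂ) * Complex.I) • (1 : A) +
      ∮ ζ in C(c, r), (ζ - c)⁻¹ • ((a - c • 1) * resolvent a ζ) := by
  have hne : ∀ z ∈ sphere c r, z - c ≠ 0 := fun z hz => sub_ne_zero.mpr (ne_of_mem_sphere hz hr.ne')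
  have hinv : ContinuousOn (fun z : ℂ => (z - c)⁻¹) (sphere c r) :=
    ContinuousOn.inv₀ (by fun_prop) hne
  have hpole : CircleIntegrable (fun z => (z - c)⁻¹ • (1 : A)) c r :=
    (hinv.smul continuousOn_const).circleIntegrable hr.le
  have hrest : CircleIntegrable (fun z => (z - c)⁻¹ • ((a - c • 1) * resolvent a z)) c r :=
    (hinv.smul (continuousOn_const.mul (continuousOn_resolvent_sphere h))).circleIntegrable hr.le
  rw [← circleIntegral.integral_sub_center_inv c hr.ne', ← circleIntegral.integral_smul_const,
    ← circleIntegral.integral_add hpole hrest]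
  refine circleIntegral.integral_congr hr.le fun z hz => ?_
  have hmul := mul_resolvent_eq_smul_sub_one (sphere_subset_resolventSet h hz)
  rw [← smul_add, sub_mul, hmul, smul_one_mul, eq_inv_smul_iff₀ (hne z hz), sub_smul]
  abel

theorem circleIntegral_resolvent (hr : 0 < r) (h : spectrum ℂ a ⊆ ball c r) :
    ∮ ζ in C(c, r), resolvent a ζ = (2 * (Real.pi : ℂ) * Complex.I) • (1 : A) := by
  have hlim : Tendsto (fun z => (a - c • 1) * resolvent a z) (Bornology.cobounded ℂ) (𝓝 0) := by
    simpa only [mul_zero] using (spectrum.resolvent_tendsto_cobounded (𝕜 := ℂ) a).const_mul _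
  have hR := (tendsto_circleIntegral_sub_inv_smul hlim c).const_add
    ((2 * (Real.pi : ℂ) * Complex.I) • (1 : A))
  rw [add_zero] at hR
  refine tendsto_nhds_unique (tendsto_const_nhds.congr' ?_) hR
  filter_upwards [eventually_ge_atTop r] with R hrR
  rw [circleIntegral_resolvent_eq_of_le hr h hrR, circleIntegral_resolvent_eq_add
    (hr.trans_le hrR) (h.trans (ball_subset_ball hrR))]

theorem circleIntegral_const_mul {f : ℂ → A} (hf : CircleIntegrable f c r) (b : A) :
    ∮ ζ in C(c, r), b * f ζ = b * ∮ ζ in C(c, r), f ζ := by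
  simpa only [circleIntegral, ContinuousLinearMap.mul_apply', mul_smul_comm] using
    ContinuousLinearMap.intervalIntegral_comp_comm (μ := MeasureTheory.volume)
      (ContinuousLinearMap.mul ℂ A b) hf.out

theorem circleIntegral_affine_mul_smul_resolvent (hr : 0 < r) (h : spectrum ℂ a ⊆ ball c r)
    {f : ℂ → ℂ} (hf : DiffContOnCl ℂ f (ball c r)) (α β : ℂ) :
    ∮ ζ in C(c, r), ((α + β * ζ) * f ζ) • resolvent a ζ =
      (α • 1 + β • a) * ∮ ζ in C(c, r), f ζ • resolvent a ζ := by
  have hfc : ContinuousOn f (sphere c r) := hf.continuousOn_ball.mono sphere_subset_closedBall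
  have hfr : CircleIntegrable (fun ζ => f ζ • resolvent a ζ) c r :=
    (hfc.smul (continuousOn_resolvent_sphere h)).circleIntegrable hr.le
  have hmain : CircleIntegrable (fun ζ => (α • 1 + β • a) * (f ζ • resolvent a ζ)) c r :=
    (continuousOn_const.mul
      (hfc.smul (continuousOn_resolvent_sphere h))).circleIntegrable hr.le
  have hrest : CircleIntegrable (fun ζ => f ζ • β • (1 : A)) c r :=
    (hfc.smul continuousOn_const).circleIntegrable hr.le
  have hcauchy : ∮ ζ in C(c, r), f ζ • β • (1 : A) = 0 := by
    rw [circleIntegral.integral_smul_const, hf.circleIntegral_eq_zero hr.le, zero_smul]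
  rw [← circleIntegral_const_mul hfr, ← add_zero (∮ ζ in C(c, r), (_ : A) * _), ← hcauchy,
    ← circleIntegral.integral_add hmain hrest]
  refine circleIntegral.integral_congr hr.le fun z hz => ?_
  have hmul := mul_resolvent_eq_smul_sub_one (sphere_subset_resolventSet h hz)
  rw [mul_smul_comm, add_mul (α • (1 : A)), smul_one_mul, smul_mul_assoc, hmul]
  module

end DunfordIntegral

section Algebra

variable {A : Type*} [Ring A] [Algebra ℂ A] {a b : A} {t : ℝ}

/-- The inverse of the point `1 + t (a - 1)` of the segment from `1` to `a`. The logarithm of `a`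
is the integral of `(a - 1) * segmentInverse a t` over `t ∈ [0, 1]`. -/
def segmentInverse (a : A) (t : ℝ) : A := Ring.inverse (1 + (t : ℂ) • (a - 1))

theorem isUnit_one_add_smul_sub_one (ha : spectrum ℂ a ⊆ Complex.slitPlane)
    (ht : t ∈ Icc (0 : ℝ) 1) : IsUnit (1 + (t : ℂ) • (a - 1)) := by
  rcases ht.1.eq_or_lt with rfl | ht0
  · simp
  have hmem : ((1 - t⁻¹ : ℝ) : ℂ) ∈ resolventSet ℂ a := by
    by_contra hspec
    have hpos := ha hspec
    rw [Complex.ofReal_mem_slitPlane, sub_pos] at hpos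
    exact ((one_le_inv₀ ht0).mpr ht.2).not_gt hpos
  have ht0' : (t : ℂ) ≠ 0 := Complex.ofReal_ne_zero.mpr ht0.ne'
  have hscale : 1 + (t : ℂ) • (a - 1) =
      Units.mk0 (-(t : ℂ)) (neg_ne_zero.mpr ht0') •
        (algebraMap ℂ A ((1 - t⁻¹ : ℝ) : ℂ) - a) := by
    rw [Units.smul_mk0, Algebra.algebraMap_eq_smul_one]
    push_cast
    match_scalars <;> field_simp
    ring
  exact hscale ▸ (spectrum.mem_resolventSet_iff.mp hmem).smul _

theorem segmentInverse_mul_cancel (ha : spectrum ℂ a ⊆ Complex.slitPlane)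
    (ht : t ∈ Icc (0 : ℝ) 1) : segmentInverse a t * (1 + (t : ℂ) • (a - 1)) = 1 :=
  Ring.inverse_mul_cancel _ (isUnit_one_add_smul_sub_one ha ht)

theorem mul_segmentInverse_cancel (ha : spectrum ℂ a ⊆ Complex.slitPlane)
    (ht : t ∈ Icc (0 : ℝ) 1) : (1 + (t : ℂ) • (a - 1)) * segmentInverse a t = 1 :=
  Ring.mul_inverse_cancel _ (isUnit_one_add_smul_sub_one ha ht)

theorem segmentInverse_sub_segmentInverse (ha : spectrum ℂ a ⊆ Complex.slitPlane)
    (hb : spectrum ℂ b ⊆ Complex.slitPlane) (ht : t ∈ Icc (0 : ℝ) 1) :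
    segmentInverse b t - segmentInverse a t =
      (t : ℂ) • (segmentInverse b t * (a - b) * segmentInverse a t) := by
  have hsub : (t : ℂ) • (a - b) = (1 + (t : ℂ) • (a - 1)) - (1 + (t : ℂ) • (b - 1)) := by module
  rw [← smul_mul_assoc, ← mul_smul_comm, hsub, mul_sub, segmentInverse_mul_cancel hb ht, sub_mul,
    mul_assoc, mul_segmentInverse_cancel ha ht, mul_one, one_mul]

theorem commute_segmentInverse (ha : spectrum ℂ a ⊆ Complex.slitPlane) (ht : t ∈ Icc (0 : ℝ) 1) :
    Commute a (segmentInverse a t) := by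
  obtain ⟨u, hu⟩ := isUnit_one_add_smul_sub_one ha ht
  rw [segmentInverse, ← hu, Ring.inverse_unit]
  refine Commute.units_inv_right ?_
  rw [hu]
  exact (Commute.one_right a).add_right (((Commute.refl a).sub_right (.one_right a)).smul_right _)

theorem map_segmentInverse {B : Type*} [Ring B] [Algebra ℂ B] (φ : A →ₐ[ℂ] B)
    (ha : spectrum ℂ a ⊆ Complex.slitPlane) (ht : t ∈ Icc (0 : ℝ) 1) :
    φ (segmentInverse a t) = segmentInverse (φ a) t := by
  refine left_inv_eq_right_inv ?_
    (mul_segmentInverse_cancel ((AlgHom.spectrum_apply_subset φ a).trans ha) ht)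
  simpa only [map_mul, map_add, map_smul, map_sub, map_one] using
    congrArg φ (segmentInverse_mul_cancel ha ht)

theorem sub_one_mul_segmentInverse_sub (ha : spectrum ℂ a ⊆ Complex.slitPlane)
    (hb : spectrum ℂ b ⊆ Complex.slitPlane) (ht : t ∈ Icc (0 : ℝ) 1) :
    (a - 1) * segmentInverse a t - (b - 1) * segmentInverse b t =
      segmentInverse a t * (a - b) * segmentInverse b t := by
  have hcomm : (a - 1) * segmentInverse a t = segmentInverse a t * (a - 1) :=
    ((commute_segmentInverse ha ht).sub_left (.one_left _)).eq
  calc (a - 1) * segmentInverse a t - (b - 1) * segmentInverse b t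
      = segmentInverse a t * (a - 1) * ((1 + (t : ℂ) • (b - 1)) * segmentInverse b t) -
        segmentInverse a t * (1 + (t : ℂ) • (a - 1)) * ((b - 1) * segmentInverse b t) := by
        rw [mul_segmentInverse_cancel hb ht, segmentInverse_mul_cancel ha ht, mul_one, one_mul,
          hcomm]
    _ = segmentInverse a t * (a - b) * segmentInverse b t := by
        simp only [mul_add, add_mul, mul_sub, sub_mul, mul_smul_comm, smul_mul_assoc, mul_one,
          one_mul, mul_assoc, smul_sub]
        abel

theorem smul_segmentInverse_mul_sub_one_mul (ha : spectrum ℂ a ⊆ Complex.slitPlane)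
    (ht : t ∈ Icc (0 : ℝ) 1) : (t : ℂ) • (segmentInverse a t * (a - 1) * segmentInverse a t) =
      segmentInverse a t - segmentInverse a t * segmentInverse a t := by
  rw [eq_sub_iff_add_eq', ← smul_mul_assoc, ← mul_smul_comm, ← add_mul, ← mul_one_add,
    segmentInverse_mul_cancel ha ht, one_mul]

/-- The kernel of the second variation of the entropy: up to `O(‖D‖³)`, the relative entropy of
`a + D` with respect to `a` is the integral of `tr (segmentWeight a t * D * segmentInverse a t * D)`
over `t ∈ [0, 1]`. -/
def segmentWeight (a : A) (t : ℝ) : A :=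
  (t : ℂ) • (a * segmentInverse a t * segmentInverse a t)

theorem segmentWeight_eq (ha : spectrum ℂ a ⊆ Complex.slitPlane) (ht : t ∈ Icc (0 : ℝ) 1) :
    segmentWeight a t =
      segmentInverse a t - ((1 - t : ℝ) : ℂ) • (segmentInverse a t * segmentInverse a t) := by
  have hsplit : (t : ℂ) • a = (1 + (t : ℂ) • (a - 1)) - ((1 - t : ℝ) : ℂ) • 1 := by
    push_cast; module
  rw [segmentWeight, ← smul_mul_assoc, ← smul_mul_assoc, hsplit, sub_mul,
    mul_segmentInverse_cancel ha ht, sub_mul, one_mul, smul_mul_assoc, smul_mul_assoc, one_mul]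

end Algebra

section Analysis

variable {A : Type*} [NormedRing A] [NormedAlgebra ℂ A] [CompleteSpace A] {a : A}

theorem hasDerivAt_segmentInverse {t : ℝ} (ha : spectrum ℂ a ⊆ Complex.slitPlane)
    (ht : t ∈ Icc (0 : ℝ) 1) :
    HasDerivAt (segmentInverse a) (-(segmentInverse a t * (a - 1) * segmentInverse a t)) t := by
  obtain ⟨u, hu⟩ := isUnit_one_add_smul_sub_one ha ht
  have hseg : HasDerivAt (fun s : ℝ => 1 + (s : ℂ) • (a - 1)) (a - 1) t := by
    simpa only [id, Complex.ofReal_one, one_smul] using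
      ((hasDerivAt_id t).ofReal_comp.smul_const (a - 1)).const_add 1
  have hinv := hasFDerivAt_ringInverse (𝕜 := ℝ) u
  have hval : segmentInverse a t = ↑u⁻¹ := by rw [segmentInverse, ← hu, Ring.inverse_unit]
  rw [hu] at hinv
  refine (hinv.comp_hasDerivAt t hseg).congr_deriv ?_
  simp [hval]

theorem continuousOn_segmentInverse (ha : spectrum ℂ a ⊆ Complex.slitPlane) :
    ContinuousOn (segmentInverse a) (Icc 0 1) := fun _ ht =>
  (hasDerivAt_segmentInverse ha ht).continuousAt.continuousWithinAt

theorem hasDerivAt_smul_segmentInverse {t : ℝ} (ha : spectrum ℂ a ⊆ Complex.slitPlane)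
    (ht : t ∈ Icc (0 : ℝ) 1) :
    HasDerivAt (fun s : ℝ => (s : ℂ) • segmentInverse a s)
      (segmentInverse a t * segmentInverse a t) t := by
  refine ((hasDerivAt_id t).ofReal_comp.smul (hasDerivAt_segmentInverse ha ht)).congr_deriv ?_
  simp [smul_segmentInverse_mul_sub_one_mul ha ht]

theorem integral_mul_segmentInverse_sq (ha : spectrum ℂ a ⊆ Complex.slitPlane) :
    ∫ t in (0 : ℝ)..1, a * (segmentInverse a t * segmentInverse a t) = 1 := by
  have hcont := continuousOn_segmentInverse ha
  have hend : a * segmentInverse a 1 = 1 := by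
    simpa using mul_segmentInverse_cancel ha (right_mem_Icc.mpr zero_le_one)
  rw [intervalIntegral.integral_eq_sub_of_hasDerivAt
    (f := fun s => a * ((s : ℂ) • segmentInverse a s))]
  · simp [hend]
  · rw [uIcc_of_le zero_le_one]
    exact fun t ht => (hasDerivAt_smul_segmentInverse ha ht).const_mul a
  · refine ContinuousOn.intervalIntegrable ?_
    rw [uIcc_of_le zero_le_one]
    exact continuousOn_const.mul (hcont.mul hcont)

theorem continuousOn_segmentWeight (ha : spectrum ℂ a ⊆ Complex.slitPlane) :
    ContinuousOn (segmentWeight a) (Icc 0 1) := by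
  have hcont := continuousOn_segmentInverse ha
  exact Complex.continuous_ofReal.continuousOn.smul ((continuousOn_const.mul hcont).mul hcont)

theorem hasDerivAt_smul_segmentInverse_mul_segmentInverse_mul {t : ℝ}
    (ha : spectrum ℂ a ⊆ Complex.slitPlane) (ht : t ∈ Icc (0 : ℝ) 1) (x : A) :
    HasDerivAt (fun s : ℝ => ((s - 1 : ℝ) : ℂ) •
        ((s : ℂ) • segmentInverse a s * x * (segmentInverse a s * x)))
      (segmentWeight a t * x * (segmentInverse a t * x) +
        segmentInverse a t * x * (segmentWeight a t * x) -
        segmentInverse a t * x * (segmentInverse a t * x)) t := by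
  have hV := hasDerivAt_segmentInverse ha ht
  have hU := hasDerivAt_smul_segmentInverse ha ht
  have hfactor := (((hasDerivAt_id t).sub_const 1).ofReal_comp).smul
    ((hU.mul_const x).mul (hV.mul_const x))
  refine hfactor.congr_deriv ?_
  have hVX : (t : ℂ) • segmentInverse a t * x *
        (-(segmentInverse a t * (a - 1) * segmentInverse a t) * x) =
      segmentInverse a t * x *
        ((segmentInverse a t * segmentInverse a t - segmentInverse a t) * x) := by
    rw [← neg_sub (segmentInverse a t), ← smul_segmentInverse_mul_sub_one_mul ha ht]
    simp only [neg_mul, mul_neg, smul_mul_assoc, mul_smul_comm]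
  simp only [hVX, segmentWeight_eq ha ht, id, Pi.mul_apply]
  push_cast
  simp only [sub_mul, mul_sub, smul_mul_assoc, mul_smul_comm, mul_assoc]
  module

theorem integral_segmentWeight_mul_mul_add (ha : spectrum ℂ a ⊆ Complex.slitPlane) (x : A) :
    ∫ t in (0 : ℝ)..1, (segmentWeight a t * x * (segmentInverse a t * x) +
        segmentInverse a t * x * (segmentWeight a t * x)) =
      ∫ t in (0 : ℝ)..1, segmentInverse a t * x * (segmentInverse a t * x) := by
  have hV := (continuousOn_segmentInverse ha).mul (continuousOn_const (c := x))
  have hW := (continuousOn_segmentWeight ha).mul (continuousOn_const (c := x))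
  rw [← uIcc_of_le zero_le_one] at hV hW
  have hVV := (hV.mul hV).intervalIntegrable (μ := MeasureTheory.volume)
  have hWV := ((hW.mul hV).add (hV.mul hW)).intervalIntegrable (μ := MeasureTheory.volume)
  refine sub_eq_zero.mp ((intervalIntegral.integral_sub hWV hVV).symm.trans ?_)
  refine (intervalIntegral.integral_eq_sub_of_hasDerivAt (fun t ht =>
    hasDerivAt_smul_segmentInverse_mul_segmentInverse_mul ha
      (by rwa [uIcc_of_le zero_le_one] at ht) x) (hWV.sub hVV)).trans ?_
  simp

end Analysis

section Logarithm

variable {A : Type*} [NormedRing A] [NormedAlgebra ℂ A] [CompleteSpace A] {a : A} {c : ℂ} {r : ℝ}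

theorem spectrum_subset_slitPlane_of_mem {z : ℂ} (hz : z ∈ Complex.slitPlane) :
    spectrum ℂ z ⊆ Complex.slitPlane := by
  rwa [← Algebra.algebraMap_self_apply z, spectrum.scalar_eq, singleton_subset_iff]

theorem diffContOnCl_segmentInverse (hs : closedBall c r ⊆ Complex.slitPlane) {t : ℝ}
    (ht : t ∈ Icc (0 : ℝ) 1) : DiffContOnCl ℂ (fun z => segmentInverse z t) (ball c r) := by
  refine DifferentiableOn.diffContOnCl fun z hz => ?_
  have hu := isUnit_one_add_smul_sub_one
    (spectrum_subset_slitPlane_of_mem (hs (closure_ball_subset_closedBall hz))) ht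
  have hseg : DifferentiableAt ℂ (fun w : ℂ => 1 + (t : ℂ) • (w - 1)) z := by fun_prop
  simp only [segmentInverse, Ring.inverse_eq_inv]
  exact (hseg.inv hu.ne_zero).differentiableWithinAt

theorem circleIntegral_segmentInverse_smul_resolvent (hr : 0 < r)
    (hs : closedBall c r ⊆ Complex.slitPlane) (h : spectrum ℂ a ⊆ ball c r) {t : ℝ}
    (ht : t ∈ Icc (0 : ℝ) 1) :
    ∮ ζ in C(c, r), segmentInverse ζ t • resolvent a ζ =
      (2 * (Real.pi : ℂ) * Complex.I) • segmentInverse a t := by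
  have ha := (h.trans ball_subset_closedBall).trans hs
  have haff := circleIntegral_affine_mul_smul_resolvent hr h (diffContOnCl_segmentInverse hs ht)
    (1 - t) t
  have hone : ∮ ζ in C(c, r), ((1 - t + t * ζ) * segmentInverse ζ t) • resolvent a ζ =
      ∮ ζ in C(c, r), resolvent a ζ := by
    refine circleIntegral.integral_congr hr.le fun z hz => ?_
    have hcancel := mul_segmentInverse_cancel
      (spectrum_subset_slitPlane_of_mem (hs (sphere_subset_closedBall hz))) ht
    rw [show (1 - t + t * z : ℂ) = 1 + (t : ℂ) • (z - 1) by rw [smul_eq_mul]; ring, hcancel,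
      one_smul]
  have hseg : (1 - t : ℂ) • (1 : A) + (t : ℂ) • a = 1 + (t : ℂ) • (a - 1) := by module
  rw [hone, hseg, circleIntegral_resolvent hr h] at haff
  rw [← one_mul (∮ ζ in C(c, r), _), ← segmentInverse_mul_cancel ha ht, mul_assoc, ← haff,
    mul_smul_comm, mul_one]

theorem circleIntegral_sub_one_mul_segmentInverse_smul_resolvent (hr : 0 < r)
    (hs : closedBall c r ⊆ Complex.slitPlane) (h : spectrum ℂ a ⊆ ball c r) {t : ℝ}
    (ht : t ∈ Icc (0 : ℝ) 1) :
    ∮ ζ in C(c, r), ((ζ - 1) * segmentInverse ζ t) • resolvent a ζ =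
      (2 * (Real.pi : ℂ) * Complex.I) • ((a - 1) * segmentInverse a t) := by
  have haff := circleIntegral_affine_mul_smul_resolvent hr h (diffContOnCl_segmentInverse hs ht)
    (-1) 1
  rw [circleIntegral_segmentInverse_smul_resolvent hr hs h ht] at haff
  simpa only [neg_one_smul, one_smul, one_mul, neg_add_eq_sub, mul_smul_comm] using haff

theorem log_eq_integral_segmentInverse {z : ℂ} (hz : z ∈ Complex.slitPlane) :
    Complex.log z = ∫ t in (0 : ℝ)..1, (z - 1) * segmentInverse z t := by
  have hlog := Complex.log_eq_integral (z := z - 1) (by rwa [add_sub_cancel])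
  rw [add_sub_cancel, ← intervalIntegral.integral_const_mul] at hlog
  simpa only [segmentInverse, Ring.inverse_eq_inv, smul_eq_mul, Complex.real_smul] using hlog

theorem circleIntegral_log_smul_resolvent (hr : 0 < r)
    (hs : closedBall c r ⊆ Complex.slitPlane) (h : spectrum ℂ a ⊆ ball c r) :
    ∮ ζ in C(c, r), Complex.log ζ • resolvent a ζ = (2 * (Real.pi : ℂ) * Complex.I) •
      ∫ t in (0 : ℝ)..1, (a - 1) * segmentInverse a t := by
  have hs' : sphere c r ⊆ Complex.slitPlane := sphere_subset_closedBall.trans hs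
  have hcont : ContinuousOn (fun x : ℂ × ℝ => ((x.1 - 1) * segmentInverse x.1 x.2) •
      resolvent a x.1) (sphere c r ×ˢ Icc 0 1) := by
    have hinv : ContinuousOn (fun x : ℂ × ℝ => segmentInverse x.1 x.2)
        (sphere c r ×ˢ Icc 0 1) := by
      simp only [segmentInverse, Ring.inverse_eq_inv]
      exact ContinuousOn.inv₀ (by fun_prop) fun x hx => (isUnit_one_add_smul_sub_one
        (spectrum_subset_slitPlane_of_mem (hs' hx.1)) hx.2).ne_zero
    exact (ContinuousOn.mul (by fun_prop) hinv).smul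
      ((continuousOn_resolvent_sphere h).comp continuousOn_fst fun x hx => hx.1)
  calc ∮ ζ in C(c, r), Complex.log ζ • resolvent a ζ
      = ∮ ζ in C(c, r), ∫ t in (0 : ℝ)..1, ((ζ - 1) * segmentInverse ζ t) • resolvent a ζ :=
        circleIntegral.integral_congr hr.le fun z hz => by
          rw [intervalIntegral.integral_smul_const, ← log_eq_integral_segmentInverse (hs' hz)]
    _ = ∫ t in (0 : ℝ)..1, ∮ ζ in C(c, r), ((ζ - 1) * segmentInverse ζ t) • resolvent a ζ :=
        circleIntegral_intervalIntegral_swap hr.le zero_le_one hcont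
    _ = ∫ t in (0 : ℝ)..1, (2 * (Real.pi : ℂ) * Complex.I) • ((a - 1) * segmentInverse a t) := by
        refine intervalIntegral.integral_congr fun t ht => ?_
        rw [uIcc_of_le zero_le_one] at ht
        exact circleIntegral_sub_one_mul_segmentInverse_smul_resolvent hr hs h ht
    _ = _ := intervalIntegral.integral_smul _ _

end Logarithm

section ScalarIntegrals

variable {z w : ℂ}

theorem integral_segmentInverse_sq (hz : z ∈ Complex.slitPlane) :
    ∫ t in (0 : ℝ)..1, segmentInverse z t * segmentInverse z t = z⁻¹ := by
  have hint := integral_mul_segmentInverse_sq (spectrum_subset_slitPlane_of_mem hz)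
  rw [intervalIntegral.integral_const_mul] at hint
  exact eq_inv_of_mul_eq_one_right hint

theorem integral_segmentInverse_mul_segmentInverse (hz : z ∈ Complex.slitPlane)
    (hw : w ∈ Complex.slitPlane) (hzw : z ≠ w) :
    ∫ t in (0 : ℝ)..1, segmentInverse z t * segmentInverse w t =
      (Complex.log z - Complex.log w) / (z - w) := by
  have hsz := spectrum_subset_slitPlane_of_mem hz
  have hsw := spectrum_subset_slitPlane_of_mem hw
  have hint : ∀ u : ℂ, spectrum ℂ u ⊆ Complex.slitPlane → IntervalIntegrable
      (fun t => (u - 1) * segmentInverse u t) MeasureTheory.volume 0 1 := fun u hu => by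
    refine ContinuousOn.intervalIntegrable (continuousOn_const.mul ?_)
    rw [uIcc_of_le zero_le_one]
    exact continuousOn_segmentInverse hu
  rw [eq_div_iff (sub_ne_zero.mpr hzw), log_eq_integral_segmentInverse hz,
    log_eq_integral_segmentInverse hw, ← intervalIntegral.integral_sub (hint z hsz) (hint w hsw),
    ← intervalIntegral.integral_mul_const]
  refine intervalIntegral.integral_congr fun t ht => ?_
  rw [uIcc_of_le zero_le_one] at ht
  rw [sub_one_mul_segmentInverse_sub hsz hsw ht, mul_right_comm]

end ScalarIntegrals

variable {H : Type*} [NormedAddCommGroup H] [InnerProductSpace ℂ H]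

section Entropy

theorem tr_mul_comm (X Y : H →L[ℂ] H) : tr (X * Y) = tr (Y * X) :=
  LinearMap.trace_mul_comm ℂ (X : H →ₗ[ℂ] H) Y

theorem HasLog.spectrum_subset_slitPlane {M : H →L[ℂ] H} (h : HasLog M) :
    spectrum ℂ M ⊆ Complex.slitPlane :=
  let ⟨_, _, hdisc, hspec⟩ := h
  (hspec.trans ball_subset_closedBall).trans hdisc

theorem opLog_eq_integral [CompleteSpace H] {M : H →L[ℂ] H} (h : HasLog M) :
    opLog M = ∫ t in (0 : ℝ)..1, (M - 1) * segmentInverse M t := by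
  obtain ⟨hr, hdisc, hspec⟩ := h.choose_spec
  rw [opLog, dif_pos h, circleIntegral_log_smul_resolvent hr hdisc hspec,
    inv_smul_smul₀ Complex.two_pi_I_ne_zero]

theorem opLog_sub_opLog [CompleteSpace H] {ρ ν : H →L[ℂ] H} (hρ : HasLog ρ) (hν : HasLog ν) :
    opLog ρ - opLog ν =
      ∫ t in (0 : ℝ)..1, segmentInverse ρ t * (ρ - ν) * segmentInverse ν t := by
  have hint : ∀ M : H →L[ℂ] H, HasLog M → IntervalIntegrable
      (fun t => (M - 1) * segmentInverse M t) MeasureTheory.volume 0 1 := fun M hM => by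
    refine ContinuousOn.intervalIntegrable (continuousOn_const.mul ?_)
    rw [uIcc_of_le zero_le_one]
    exact continuousOn_segmentInverse hM.spectrum_subset_slitPlane
  rw [opLog_eq_integral hρ, opLog_eq_integral hν,
    ← intervalIntegral.integral_sub (hint ρ hρ) (hint ν hν)]
  refine intervalIntegral.integral_congr fun t ht => ?_
  rw [uIcc_of_le zero_le_one] at ht
  exact sub_one_mul_segmentInverse_sub hρ.spectrum_subset_slitPlane hν.spectrum_subset_slitPlane ht

variable [FiniteDimensional ℂ H]

/-- The trace as a continuous functional, which can be moved under integral signs. -/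
def trCLM (H : Type*) [NormedAddCommGroup H] [InnerProductSpace ℂ H] [FiniteDimensional ℂ H] :
    (H →L[ℂ] H) →L[ℂ] ℂ :=
  LinearMap.toContinuousLinearMap (LinearMap.trace ℂ H ∘ₗ ContinuousLinearMap.coeLM ℂ)

theorem trCLM_apply (X : H →L[ℂ] H) : trCLM H X = tr X := rfl

theorem norm_tr_le (X : H →L[ℂ] H) : ‖tr X‖ ≤ Module.finrank ℂ H * ‖X‖ := by
  let b := stdOrthonormalBasis ℂ H
  rw [tr, LinearMap.trace_eq_sum_inner _ b]
  calc ‖∑ i, inner ℂ (b i) (X (b i))‖ ≤ ∑ _i : Fin (Module.finrank ℂ H), ‖X‖ := by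
        refine norm_sum_le_of_le _ fun i _ => (norm_inner_le_norm _ _).trans ?_
        rw [b.norm_eq_one, one_mul]
        exact X.unit_le_opNorm _ (b.norm_eq_one i).le
    _ = Module.finrank ℂ H * ‖X‖ := by simp

theorem tr_integral {f : ℝ → H →L[ℂ] H} (hf : ContinuousOn f (Icc 0 1)) :
    tr (∫ t in (0 : ℝ)..1, f t) = ∫ t in (0 : ℝ)..1, tr (f t) := by
  rw [← uIcc_of_le zero_le_one] at hf
  exact ((trCLM H).intervalIntegral_comp_comm hf.intervalIntegrable).symm

theorem tr_mul_integral {f : ℝ → H →L[ℂ] H} (hf : ContinuousOn f (Icc 0 1)) (Y : H →L[ℂ] H) :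
    tr (Y * ∫ t in (0 : ℝ)..1, f t) = ∫ t in (0 : ℝ)..1, tr (Y * f t) := by
  rw [← uIcc_of_le zero_le_one] at hf
  exact ((trCLM H ∘L ContinuousLinearMap.mul ℂ (H →L[ℂ] H) Y).intervalIntegral_comp_comm
    hf.intervalIntegrable).symm

theorem continuousOn_tr {f : ℝ → H →L[ℂ] H} {s : Set ℝ} (hf : ContinuousOn f s) :
    ContinuousOn (fun t => tr (f t)) s :=
  (trCLM H).continuous.comp_continuousOn hf

theorem tr_mul_segmentInverse_mul_sub_mul_segmentInverse {ρ ν : H →L[ℂ] H}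
    (hρ : spectrum ℂ ρ ⊆ Complex.slitPlane) (hν : spectrum ℂ ν ⊆ Complex.slitPlane) {t : ℝ}
    (ht : t ∈ Icc (0 : ℝ) 1) :
    tr (ρ * (segmentInverse ρ t * (ρ - ν) * segmentInverse ν t)) =
      tr (ρ * (segmentInverse ρ t * segmentInverse ρ t) * (ρ - ν)) +
        tr (segmentWeight ρ t * (ρ - ν) * (segmentInverse ν t * (ρ - ν))) := by
  have hcomm : segmentInverse ρ t * (ρ * segmentInverse ρ t) =
      ρ * (segmentInverse ρ t * segmentInverse ρ t) := by
    rw [← mul_assoc, ← (commute_segmentInverse hρ ht).eq, mul_assoc]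
  have hν_eq : segmentInverse ν t = segmentInverse ρ t +
      (t : ℂ) • (segmentInverse ν t * (ρ - ν) * segmentInverse ρ t) := by
    rw [← segmentInverse_sub_segmentInverse hρ hν ht, add_sub_cancel]
  have hcycle : ∀ X : H →L[ℂ] H, tr (ρ * (segmentInverse ρ t * (X * segmentInverse ρ t))) =
      tr (ρ * (segmentInverse ρ t * segmentInverse ρ t) * X) := fun X => by
    rw [← mul_assoc, ← mul_assoc, tr_mul_comm, ← mul_assoc, hcomm]
  calc tr (ρ * (segmentInverse ρ t * (ρ - ν) * segmentInverse ν t))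
      = tr (ρ * (segmentInverse ρ t * ((ρ - ν) * segmentInverse ρ t))) +
          tr (ρ * (segmentInverse ρ t *
            ((t : ℂ) • ((ρ - ν) * (segmentInverse ν t * (ρ - ν))) * segmentInverse ρ t))) := by
        conv_lhs => rw [hν_eq]
        simp only [← trCLM_apply, ← map_add, mul_add, mul_smul_comm, smul_mul_assoc, mul_assoc]
    _ = _ := by
        rw [hcycle, hcycle, segmentWeight]
        simp only [mul_smul_comm, smul_mul_assoc, mul_assoc]

theorem integral_tr_mul_segmentInverse_sq_mul {ρ : H →L[ℂ] H}
    (hρ : spectrum ℂ ρ ⊆ Complex.slitPlane) (X : H →L[ℂ] H) :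
    ∫ t in (0 : ℝ)..1, tr (ρ * (segmentInverse ρ t * segmentInverse ρ t) * X) = tr X := by
  have hV := continuousOn_segmentInverse hρ
  simp only [tr_mul_comm _ X]
  refine (tr_mul_integral (continuousOn_const.mul (hV.mul hV)) X).symm.trans ?_
  simp only [Pi.mul_apply, integral_mul_segmentInverse_sq hρ, mul_one]

theorem relEntropy_eq_integral {ρ ν : H →L[ℂ] H} (hρ : HasLog ρ) (hν : HasLog ν)
    (htr : tr ρ = tr ν) :
    relEntropy ρ ν = ∫ t in (0 : ℝ)..1,
      tr (segmentWeight ρ t * (ρ - ν) * (segmentInverse ν t * (ρ - ν))) := by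
  have hsρ := hρ.spectrum_subset_slitPlane
  have hsν := hν.spectrum_subset_slitPlane
  have hVρ := continuousOn_segmentInverse hsρ
  have hVν := continuousOn_segmentInverse hsν
  have hint : ContinuousOn
      (fun t => segmentInverse ρ t * (ρ - ν) * segmentInverse ν t) (Icc 0 1) :=
    (hVρ.mul continuousOn_const).mul hVν
  have hfirst : ContinuousOn
      (fun t => tr (ρ * (segmentInverse ρ t * segmentInverse ρ t) * (ρ - ν))) (uIcc 0 1) := by
    rw [uIcc_of_le zero_le_one]
    exact continuousOn_tr ((continuousOn_const.mul (hVρ.mul hVρ)).mul continuousOn_const)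
  have hsecond : ContinuousOn
      (fun t => tr (segmentWeight ρ t * (ρ - ν) * (segmentInverse ν t * (ρ - ν)))) (uIcc 0 1) := by
    rw [uIcc_of_le zero_le_one]
    exact continuousOn_tr (((continuousOn_segmentWeight hsρ).mul continuousOn_const).mul
      (hVν.mul continuousOn_const))
  have htr_sub : tr (ρ - ν) = 0 := by
    rw [← trCLM_apply, map_sub, trCLM_apply, trCLM_apply, htr, sub_self]
  rw [relEntropy, opLog_sub_opLog hρ hν, tr_mul_integral hint,
    ← zero_add (∫ t in (0 : ℝ)..1, tr (segmentWeight ρ t * _ * _)), ← htr_sub,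
    ← integral_tr_mul_segmentInverse_sq_mul hsρ,
    ← intervalIntegral.integral_add hfirst.intervalIntegrable hsecond.intervalIntegrable]
  refine intervalIntegral.integral_congr fun t ht => ?_
  rw [uIcc_of_le zero_le_one] at ht
  exact tr_mul_segmentInverse_mul_sub_mul_segmentInverse hsρ hsν ht

theorem integral_tr_segmentWeight_mul {a : H →L[ℂ] H} (ha : spectrum ℂ a ⊆ Complex.slitPlane)
    (X : H →L[ℂ] H) :
    ∫ t in (0 : ℝ)..1, tr (segmentWeight a t * X * (segmentInverse a t * X)) =
      2⁻¹ * ∫ t in (0 : ℝ)..1, tr (segmentInverse a t * X * (segmentInverse a t * X)) := by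
  have hV := (continuousOn_segmentInverse ha).mul (continuousOn_const (c := X))
  have hW := (continuousOn_segmentWeight ha).mul (continuousOn_const (c := X))
  have hsymm := ((tr_integral ((hW.mul hV).add (hV.mul hW))).symm.trans
    (congrArg tr (integral_segmentWeight_mul_mul_add ha X))).trans (tr_integral (hV.mul hV))
  refine eq_inv_mul_iff_mul_eq₀ two_ne_zero |>.mpr (Eq.trans ?_ hsymm)
  rw [← intervalIntegral.integral_const_mul]
  refine intervalIntegral.integral_congr fun t _ => ?_
  simp only [Pi.add_apply, Pi.mul_apply, ← trCLM_apply, map_add]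
  rw [trCLM_apply, trCLM_apply, tr_mul_comm (segmentInverse a t * X), two_mul]

end Entropy

theorem sum_sum_eq_sum_diag_add_two_nsmul {ι M : Type*} [Fintype ι] [LinearOrder ι]
    [LocallyFiniteOrderTop ι] [LocallyFiniteOrderBot ι] [AddCommMonoid M] (g : ι → ι → M)
    (hg : ∀ i j, g i j = g j i) :
    ∑ i, ∑ j, g i j = ∑ i, g i i + 2 • ∑ i, ∑ j ∈ Finset.Ioi i, g j i := by
  calc ∑ i, ∑ j, g i j = ∑ i, (g i i + ∑ j ∈ {i}ᶜ, g j i) := by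
        rw [Finset.sum_comm]
        exact Finset.sum_congr rfl fun i _ => Fintype.sum_eq_add_sum_compl i _
    _ = ∑ i, g i i + ∑ i, ∑ j ∈ Finset.Ioi i, (g j i + g i j) := by
        rw [Finset.sum_add_distrib, Finset.sum_sum_Ioi_add_eq_sum_sum_off_diag]
    _ = _ := by
        simp only [Finset.smul_sum, two_nsmul]
        exact congrArg _ (Finset.sum_congr rfl fun i _ => Finset.sum_congr rfl fun j _ =>
          congrArg _ (hg i j))

theorem spectrum_pi_ofReal_subset_slitPlane {ι : Type*} {μ : ι → ℝ} (hμ : ∀ i, 0 < μ i) :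
    spectrum ℂ (fun i => (μ i : ℂ)) ⊆ Complex.slitPlane := by
  rw [Pi.spectrum_eq]
  exact iUnion_subset fun i =>
    spectrum_subset_slitPlane_of_mem (Complex.ofReal_mem_slitPlane.mpr (hμ i))

namespace IsSpectralDecomposition

variable {n : ℕ} {μ : Fin n → ℝ} {p : Fin n → H →L[ℂ] H} {η : H →L[ℂ] H} [CompleteSpace H]

/-- The functional calculus of a spectral decomposition: a function `f` of the index of the
eigenvalue is sent to `∑ i, f i • p i`. -/
def spectralCalculus (h : IsSpectralDecomposition η μ p) :
    (Fin n → ℂ) →⋆ₐ[ℂ] (H →L[ℂ] H) where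
  toFun f := ∑ i, f i • p i
  map_one' := by simp only [Pi.one_apply, one_smul, h.sum_eq_one]
  map_mul' f g := by
    rw [Finset.sum_mul_sum]
    refine Finset.sum_congr rfl fun i _ => ?_
    rw [Finset.sum_eq_single_of_mem i (Finset.mem_univ i) fun j _ hj => by
      rw [smul_mul_smul_comm, h.orthogonal i j hj.symm, smul_zero], smul_mul_smul_comm,
      (h.projection i).isIdempotentElem.eq, Pi.mul_apply]
  map_zero' := by simp only [Pi.zero_apply, zero_smul, Finset.sum_const_zero]
  map_add' f g := by simp only [Pi.add_apply, add_smul, Finset.sum_add_distrib]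
  commutes' c := by
    simp only [Pi.algebraMap_apply, Algebra.algebraMap_self_apply, ← Finset.smul_sum,
      h.sum_eq_one, Algebra.algebraMap_eq_smul_one]
  map_star' f := by
    simp only [star_sum, star_smul, Pi.star_apply, (h.projection _).isSelfAdjoint.star_eq]

theorem spectralCalculus_apply (h : IsSpectralDecomposition η μ p) (f : Fin n → ℂ) :
    h.spectralCalculus f = ∑ i, f i • p i := rfl

theorem spectralCalculus_eigenvalues (h : IsSpectralDecomposition η μ p) :
    h.spectralCalculus (fun i => (μ i : ℂ)) = η := h.eq_sum.symm

theorem norm_spectralCalculus_le (h : IsSpectralDecomposition η μ p) {f : Fin n → ℂ} {C : ℝ}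
    (hC : 0 ≤ C) (hf : ∀ i, ‖f i‖ ≤ C) : ‖h.spectralCalculus f‖ ≤ C :=
  (NonUnitalStarAlgHom.norm_apply_le h.spectralCalculus f).trans
    ((pi_norm_le_iff_of_nonneg hC).mpr hf)

theorem spectrum_subset_slitPlane (h : IsSpectralDecomposition η μ p) (hμ : ∀ i, 0 < μ i) :
    spectrum ℂ η ⊆ Complex.slitPlane := by
  rw [← h.spectralCalculus_eigenvalues]
  exact (AlgHom.spectrum_apply_subset (h.spectralCalculus : (Fin n → ℂ) →ₐ[ℂ] (H →L[ℂ] H)) _).trans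
    (spectrum_pi_ofReal_subset_slitPlane hμ)

theorem segmentInverse_eq (h : IsSpectralDecomposition η μ p) (hμ : ∀ i, 0 < μ i) {t : ℝ}
    (ht : t ∈ Icc (0 : ℝ) 1) :
    segmentInverse η t = h.spectralCalculus fun i => segmentInverse (μ i : ℂ) t := by
  have hspec := spectrum_pi_ofReal_subset_slitPlane hμ
  have heval : (fun i => segmentInverse (μ i : ℂ) t) = segmentInverse (fun i => (μ i : ℂ)) t :=
    funext fun i => (map_segmentInverse (Pi.evalAlgHom ℂ (fun _ : Fin n => ℂ) i) hspec ht).symm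
  have := map_segmentInverse (h.spectralCalculus : (Fin n → ℂ) →ₐ[ℂ] (H →L[ℂ] H)) hspec ht
  rw [heval]
  refine Eq.trans ?_ this.symm
  conv_lhs => rw [← h.spectralCalculus_eigenvalues]
  rfl

theorem mem_spectrum (h : IsSpectralDecomposition η μ p) (i : Fin n) : μ i ∈ spectrum ℝ η := by
  intro hunit
  have hsingle : h.spectralCalculus (Pi.single i 1) = p i := by
    simp [spectralCalculus_apply, Pi.single_apply]
  have hzero : (algebraMap ℝ (H →L[ℂ] H) (μ i) - η) * p i = 0 := by
    have hfun : ((μ i : ℂ) • 1 - fun j => (μ j : ℂ)) * Pi.single i 1 = 0 := by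
      ext j
      rcases eq_or_ne j i with rfl | hj
      · simp
      · simp [hj]
    have hη : algebraMap ℝ (H →L[ℂ] H) (μ i) - η =
        h.spectralCalculus ((μ i : ℂ) • 1 - fun j => (μ j : ℂ)) := by
      rw [map_sub, map_smul, map_one, h.spectralCalculus_eigenvalues,
        Algebra.algebraMap_eq_smul_one, Complex.coe_smul]
    rw [hη, ← hsingle, ← map_mul, hfun, map_zero]
  exact h.ne_zero i (hunit.mul_right_eq_zero.mp hzero)

theorem norm_segmentInverse_le (h : IsSpectralDecomposition η μ p) {m : ℝ} (hm : 0 < m)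
    (hm1 : m ≤ 1) (hμ : ∀ i, m ≤ μ i) {t : ℝ} (ht : t ∈ Icc (0 : ℝ) 1) :
    ‖segmentInverse η t‖ ≤ m⁻¹ := by
  rw [h.segmentInverse_eq (fun i => hm.trans_le (hμ i)) ht]
  refine h.norm_spectralCalculus_le (inv_nonneg.mpr hm.le) fun i => ?_
  have hseg : m ≤ 1 + t * (μ i - 1) := by nlinarith [ht.1, ht.2, hμ i]
  have hcast : (1 : ℂ) + (t : ℂ) • ((μ i : ℂ) - 1) = ((1 + t * (μ i - 1) : ℝ) : ℂ) := by
    push_cast [smul_eq_mul]; rfl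
  rw [segmentInverse, hcast, Ring.inverse_eq_inv, norm_inv,
    Complex.norm_of_nonneg (hm.le.trans hseg)]
  exact inv_anti₀ hm hseg

theorem tr_segmentInverse_mul_mul [FiniteDimensional ℂ H] (h : IsSpectralDecomposition η μ p)
    (hμ : ∀ i, 0 < μ i) {t : ℝ} (ht : t ∈ Icc (0 : ℝ) 1) (X : H →L[ℂ] H) :
    tr (segmentInverse η t * X * (segmentInverse η t * X)) =
      ∑ i, ∑ j, segmentInverse (μ i : ℂ) t * segmentInverse (μ j : ℂ) t *
        tr (X * p i * X * p j) := by
  rw [mul_assoc, tr_mul_comm, ← mul_assoc, h.segmentInverse_eq hμ ht, spectralCalculus_apply]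
  simp only [Finset.mul_sum, Finset.sum_mul, ← trCLM_apply, map_sum, smul_mul_assoc, mul_smul_comm,
    map_smul, smul_eq_mul]
  rw [Finset.sum_comm]
  refine Finset.sum_congr rfl fun i _ => Finset.sum_congr rfl fun j _ => ?_
  ring

theorem integral_tr_segmentInverse_mul_mul [FiniteDimensional ℂ H]
    (h : IsSpectralDecomposition η μ p) (hμ : ∀ i, 0 < μ i) (X : H →L[ℂ] H) :
    ∫ t in (0 : ℝ)..1, tr (segmentInverse η t * X * (segmentInverse η t * X)) =
      ∑ i, ∑ j, (∫ t in (0 : ℝ)..1, segmentInverse (μ i : ℂ) t * segmentInverse (μ j : ℂ) t) *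
        tr (X * p i * X * p j) := by
  have hV : ∀ i, ContinuousOn (segmentInverse (μ i : ℂ)) (uIcc 0 1) := fun i => by
    rw [uIcc_of_le zero_le_one]
    exact continuousOn_segmentInverse
      (spectrum_subset_slitPlane_of_mem (Complex.ofReal_mem_slitPlane.mpr (hμ i)))
  have hint : ∀ i j, IntervalIntegrable (fun t => segmentInverse (μ i : ℂ) t *
      segmentInverse (μ j : ℂ) t * tr (X * p i * X * p j)) MeasureTheory.volume 0 1 := fun i j =>
    (((hV i).mul (hV j)).mul continuousOn_const).intervalIntegrable
  simp only [← intervalIntegral.integral_mul_const]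
  calc ∫ t in (0 : ℝ)..1, tr (segmentInverse η t * X * (segmentInverse η t * X))
      = ∫ t in (0 : ℝ)..1, ∑ i, ∑ j, segmentInverse (μ i : ℂ) t * segmentInverse (μ j : ℂ) t *
          tr (X * p i * X * p j) := by
        refine intervalIntegral.integral_congr fun t ht => ?_
        rw [uIcc_of_le zero_le_one] at ht
        exact h.tr_segmentInverse_mul_mul hμ ht X
    _ = ∑ i, ∑ j, ∫ t in (0 : ℝ)..1, segmentInverse (μ i : ℂ) t * segmentInverse (μ j : ℂ) t *
          tr (X * p i * X * p j) := by
        have hint_sum : ∀ i, IntervalIntegrable (fun t => ∑ j, segmentInverse (μ i : ℂ) t *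
            segmentInverse (μ j : ℂ) t * tr (X * p i * X * p j)) MeasureTheory.volume 0 1 :=
          fun i => by simpa only [Finset.sum_fn] using
            IntervalIntegrable.sum Finset.univ fun j _ => hint i j
        rw [intervalIntegral.integral_finsetSum fun i _ => hint_sum i]
        exact Finset.sum_congr rfl fun i _ =>
          intervalIntegral.integral_finsetSum fun j _ => hint i j

theorem sum_sum_integral_mul_tr_eq_two_mul_quadF (h : IsSpectralDecomposition η μ p)
    (hμ : ∀ i, 0 < μ i) (X : H →L[ℂ] H) :
    ∑ i, ∑ j, (∫ t in (0 : ℝ)..1, segmentInverse (μ i : ℂ) t * segmentInverse (μ j : ℂ) t) *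
      tr (X * p i * X * p j) = 2 * quadF μ p X := by
  set g : Fin n → Fin n → ℂ := fun i j =>
    (∫ t in (0 : ℝ)..1, segmentInverse (μ i : ℂ) t * segmentInverse (μ j : ℂ) t) *
      tr (X * p i * X * p j) with hg
  have hsymm : ∀ i j, g i j = g j i := fun i j => by
    simp only [hg, mul_comm (segmentInverse (μ i : ℂ) _)]
    rw [mul_assoc, tr_mul_comm, ← mul_assoc]
  have hslit : ∀ i, (μ i : ℂ) ∈ Complex.slitPlane := fun i =>
    Complex.ofReal_mem_slitPlane.mpr (hμ i)
  have hdiag : ∀ i,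
      g i i = 2 * (tr (X * p i * X * p i) * ((1 / (2 * μ i) : ℝ) : ℂ)) := fun i => by
    have hne : (μ i : ℂ) ≠ 0 := Complex.slitPlane_ne_zero (hslit i)
    simp only [hg, integral_segmentInverse_sq (hslit i)]
    push_cast
    field_simp
  have hoff : ∀ i j, i ≠ j → g j i = tr (X * p j * X * p i) *
      (((Real.log (μ i) - Real.log (μ j)) / (μ i - μ j) : ℝ) : ℂ) := fun i j hij => by
    have hne : (μ i : ℂ) ≠ μ j := Complex.ofReal_injective.ne (h.injective.ne hij)
    simp only [hg, mul_comm (segmentInverse (μ j : ℂ) _),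
      integral_segmentInverse_mul_segmentInverse (hslit i) (hslit j) hne]
    rw [mul_comm]
    push_cast [Complex.ofReal_log (hμ i).le, Complex.ofReal_log (hμ j).le]
    rfl
  rw [sum_sum_eq_sum_diag_add_two_nsmul g hsymm, quadF, bilinF, mul_add, Finset.mul_sum,
    nsmul_eq_mul, Nat.cast_ofNat]
  congr 1
  · exact Finset.sum_congr rfl fun i _ => hdiag i
  · congr 1
    exact Finset.sum_congr rfl fun i _ => Finset.sum_congr rfl fun j hj =>
      hoff i j (Finset.mem_Ioi.mp hj).ne

theorem quadF_eq_integral [FiniteDimensional ℂ H] (h : IsSpectralDecomposition η μ p)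
    (hμ : ∀ i, 0 < μ i) (X : H →L[ℂ] H) :
    quadF μ p X =
      ∫ t in (0 : ℝ)..1, tr (segmentWeight η t * X * (segmentInverse η t * X)) := by
  rw [integral_tr_segmentWeight_mul (h.spectrum_subset_slitPlane hμ),
    h.integral_tr_segmentInverse_mul_mul hμ, h.sum_sum_integral_mul_tr_eq_two_mul_quadF hμ,
    inv_mul_cancel_left₀ two_ne_zero]

end IsSpectralDecomposition

section ResolventEstimates

variable {A : Type*} [NormedRing A] [NormedAlgebra ℂ A] {a d : A} {t C : ℝ}

theorem norm_segmentInverse_sub_le {b : A} (ha : spectrum ℂ a ⊆ Complex.slitPlane)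
    (hb : spectrum ℂ b ⊆ Complex.slitPlane) (ht : t ∈ Icc (0 : ℝ) 1) :
    ‖segmentInverse b t - segmentInverse a t‖ ≤
      ‖segmentInverse b t‖ * ‖a - b‖ * ‖segmentInverse a t‖ := by
  have ht_norm : ‖(t : ℂ)‖ ≤ 1 := (Complex.norm_of_nonneg ht.1).trans_le ht.2
  rw [segmentInverse_sub_segmentInverse ha hb ht, norm_smul]
  exact (mul_le_of_le_one_left (norm_nonneg _) ht_norm).trans norm_mul₃_le

theorem norm_segmentWeight_le (ha : spectrum ℂ a ⊆ Complex.slitPlane) (ht : t ∈ Icc (0 : ℝ) 1)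
    (hC : ‖segmentInverse a t‖ ≤ C) (hC1 : 1 ≤ C) : ‖segmentWeight a t‖ ≤ 2 * C ^ 2 := by
  have ht_norm : ‖((1 - t : ℝ) : ℂ)‖ ≤ 1 := by
    rw [Complex.norm_of_nonneg (sub_nonneg.mpr ht.2)]; linarith [ht.1]
  rw [segmentWeight_eq ha ht]
  calc _ ≤ ‖segmentInverse a t‖ + ‖((1 - t : ℝ) : ℂ) • (segmentInverse a t * segmentInverse a t)‖ :=
        norm_sub_le _ _
    _ ≤ C + 1 * (C * C) := by
        rw [norm_smul]
        gcongr
        exact (norm_mul_le _ _).trans (by gcongr)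
    _ ≤ 2 * C ^ 2 := by nlinarith

theorem norm_segmentInverse_add_le
    (ha : spectrum ℂ a ⊆ Complex.slitPlane) (had : spectrum ℂ (a + d) ⊆ Complex.slitPlane)
    (ht : t ∈ Icc (0 : ℝ) 1) (hC : ‖segmentInverse a t‖ ≤ C) (hd : C * ‖d‖ ≤ 1 / 2) :
    ‖segmentInverse (a + d) t‖ ≤ 2 * C := by
  have hsub := norm_segmentInverse_sub_le ha had ht
  rw [sub_add_cancel_left, norm_neg] at hsub
  have htri := norm_le_norm_add_norm_sub' (segmentInverse (a + d) t) (segmentInverse a t)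
  have hhalf : ‖segmentInverse (a + d) t‖ * ‖d‖ * ‖segmentInverse a t‖ ≤
      ‖segmentInverse (a + d) t‖ * (1 / 2) := by
    rw [mul_assoc]
    gcongr
    exact (mul_comm _ _).trans_le ((by gcongr : _ ≤ C * ‖d‖).trans hd)
  linarith

theorem norm_segmentInverse_add_sub_le
    (ha : spectrum ℂ a ⊆ Complex.slitPlane) (had : spectrum ℂ (a + d) ⊆ Complex.slitPlane)
    (ht : t ∈ Icc (0 : ℝ) 1) (hC : ‖segmentInverse a t‖ ≤ C) (hd : C * ‖d‖ ≤ 1 / 2) :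
    ‖segmentInverse (a + d) t - segmentInverse a t‖ ≤ 2 * C ^ 2 * ‖d‖ := by
  have hC0 : 0 ≤ C := (norm_nonneg _).trans hC
  calc ‖segmentInverse (a + d) t - segmentInverse a t‖
      ≤ ‖segmentInverse (a + d) t‖ * ‖d‖ * ‖segmentInverse a t‖ := by
        simpa only [sub_add_cancel_left, norm_neg] using norm_segmentInverse_sub_le ha had ht
    _ ≤ 2 * C * ‖d‖ * C := by gcongr; exact norm_segmentInverse_add_le ha had ht hC hd
    _ = 2 * C ^ 2 * ‖d‖ := by ring

theorem norm_segmentWeight_add_sub_le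
    (ha : spectrum ℂ a ⊆ Complex.slitPlane) (had : spectrum ℂ (a + d) ⊆ Complex.slitPlane)
    (ht : t ∈ Icc (0 : ℝ) 1) (hC : ‖segmentInverse a t‖ ≤ C) (hd : C * ‖d‖ ≤ 1 / 2)
    (hC1 : 1 ≤ C) :
    ‖segmentWeight (a + d) t - segmentWeight a t‖ ≤ 8 * C ^ 3 * ‖d‖ := by
  have ht_norm : ‖((1 - t : ℝ) : ℂ)‖ ≤ 1 := by
    rw [Complex.norm_of_nonneg (sub_nonneg.mpr ht.2)]; linarith [ht.1]
  have hU := norm_segmentInverse_add_le ha had ht hC hd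
  have hUV := norm_segmentInverse_add_sub_le ha had ht hC hd
  rw [segmentWeight_eq ha ht, segmentWeight_eq had ht]
  set U := segmentInverse (a + d) t
  set V := segmentInverse a t
  calc ‖U - ((1 - t : ℝ) : ℂ) • (U * U) - (V - ((1 - t : ℝ) : ℂ) • (V * V))‖
      = ‖(U - V) - ((1 - t : ℝ) : ℂ) • ((U - V) * U + V * (U - V))‖ := by
        congr 1
        rw [sub_mul, mul_sub]
        module
    _ ≤ ‖U - V‖ + 1 * (‖U - V‖ * ‖U‖ + ‖V‖ * ‖U - V‖) := by
        refine (norm_sub_le _ _).trans ?_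
        rw [norm_smul]
        gcongr
        exact (norm_add_le _ _).trans (add_le_add (norm_mul_le _ _) (norm_mul_le _ _))
    _ ≤ 2 * C ^ 2 * ‖d‖ + 1 * (2 * C ^ 2 * ‖d‖ * (2 * C) + C * (2 * C ^ 2 * ‖d‖)) := by gcongr
    _ = 2 * C ^ 2 * 1 * ‖d‖ + 6 * C ^ 3 * ‖d‖ := by ring
    _ ≤ 2 * C ^ 2 * C * ‖d‖ + 6 * C ^ 3 * ‖d‖ := by gcongr
    _ = 8 * C ^ 3 * ‖d‖ := by ring

end ResolventEstimates

section RelEntropyEstimate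

theorem hasLog_of_norm_sub_lt [CompleteSpace H] {M : H →L[ℂ] H} {c : ℝ}
    (hM : ‖M - (c : ℂ) • 1‖ < c) : HasLog M := by
  obtain ⟨r, hMr, hrc⟩ := exists_between hM
  refine ⟨(c, r), (norm_nonneg _).trans_lt hMr, fun z hz => Or.inl ?_, fun z hz => ?_⟩
  · have hre : |(z - c).re| ≤ r := (Complex.abs_re_le_norm _).trans (mem_closedBall_iff_norm.mp hz)
    rw [Complex.sub_re, Complex.ofReal_re] at hre
    linarith [neg_le_of_abs_le hre]
  · have hshift : z - c ∈ spectrum ℂ (M - (c : ℂ) • 1) := by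
      rwa [← Algebra.algebraMap_eq_smul_one, ← neg_add_eq_sub _ M, ← spectrum.add_mem_iff,
        sub_add_cancel]
    rw [mem_ball_iff_norm]
    calc ‖z - c‖ ≤ ‖M - (c : ℂ) • 1‖ * ‖(1 : H →L[ℂ] H)‖ := spectrum.norm_le_norm_mul_of_mem hshift
      _ ≤ ‖M - (c : ℂ) • 1‖ :=
        mul_le_of_le_one_right (norm_nonneg _) ContinuousLinearMap.norm_id_le
      _ < r := hMr

variable [CompleteSpace H] {n : ℕ} {μ : Fin n → ℝ} {p : Fin n → H →L[ℂ] H} {η D D₁ D₂ : H →L[ℂ] H}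
  {m : ℝ}

theorem IsSpectralDecomposition.hasLog_add (h : IsSpectralDecomposition η μ p) (hm : 0 < m)
    (hμ : ∀ i, m ≤ μ i) (hD : ‖D‖ < m) : HasLog (η + D) := by
  set c : ℝ := m + ∑ i, μ i with hc
  have hμ_le : ∀ i, μ i ≤ ∑ j, μ j := fun i =>
    Finset.single_le_sum (fun j _ => hm.le.trans (hμ j)) (Finset.mem_univ i)
  have hη : ‖η - (c : ℂ) • 1‖ ≤ c - m := by
    rw [← h.spectralCalculus_eigenvalues, ← map_one h.spectralCalculus, ← map_smul, ← map_sub]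
    refine h.norm_spectralCalculus_le ?_ fun i => ?_
    · rw [hc, add_sub_cancel_left]
      exact Finset.sum_nonneg fun i _ => hm.le.trans (hμ i)
    · simp only [Pi.sub_apply, Pi.smul_apply, Pi.one_apply, smul_eq_mul, mul_one]
      rw [← Complex.ofReal_sub, Complex.norm_real, Real.norm_eq_abs, abs_le]
      constructor <;> linarith [hμ i, hμ_le i]
  refine hasLog_of_norm_sub_lt (c := c) ?_
  rw [add_sub_right_comm]
  linarith [norm_add_le (η - (c : ℂ) • 1) D]

variable [FiniteDimensional ℂ H]

theorem norm_tr_mul_sub_tr_mul_le (W W' V V' X : H →L[ℂ] H) :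
    ‖tr (W' * X * (V' * X)) - tr (W * X * (V * X))‖ ≤
      Module.finrank ℂ H * ((‖W' - W‖ * ‖V'‖ + ‖W‖ * ‖V' - V‖) * ‖X‖ ^ 2) := by
  have hsplit : W' * X * (V' * X) - W * X * (V * X) =
      (W' - W) * X * V' * X + W * X * (V' - V) * X := by noncomm_ring
  have hnorm : ∀ P Q : H →L[ℂ] H, ‖P * X * Q * X‖ ≤ ‖P‖ * ‖Q‖ * ‖X‖ ^ 2 := fun P Q => by
    calc ‖P * X * Q * X‖ ≤ ‖P‖ * ‖X‖ * ‖Q‖ * ‖X‖ :=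
          (norm_mul_le _ _).trans (by gcongr; exact norm_mul₃_le)
      _ = ‖P‖ * ‖Q‖ * ‖X‖ ^ 2 := by ring
  rw [← trCLM_apply, ← trCLM_apply, ← map_sub, trCLM_apply, hsplit, add_mul]
  refine (norm_tr_le _).trans ?_
  gcongr
  exact (norm_add_le _ _).trans (add_le_add (hnorm _ _) (hnorm _ _))

theorem norm_tr_segmentWeight_mul_sub_le {t C : ℝ} (hη : spectrum ℂ η ⊆ Complex.slitPlane)
    (h₁ : spectrum ℂ (η + D₁) ⊆ Complex.slitPlane) (h₂ : spectrum ℂ (η + D₂) ⊆ Complex.slitPlane)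
    (ht : t ∈ Icc (0 : ℝ) 1) (hC : ‖segmentInverse η t‖ ≤ C) (hC1 : 1 ≤ C)
    (hD₁ : C * ‖D₁‖ ≤ 1 / 2) (hD₂ : C * ‖D₂‖ ≤ 1 / 2) (X : H →L[ℂ] H) :
    ‖tr (segmentWeight (η + D₁) t * X * (segmentInverse (η + D₂) t * X)) -
        tr (segmentWeight η t * X * (segmentInverse η t * X))‖ ≤
      Module.finrank ℂ H * (16 * C ^ 4 * (‖D₁‖ + ‖D₂‖) * ‖X‖ ^ 2) := by
  refine (norm_tr_mul_sub_tr_mul_le _ _ _ _ X).trans ?_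
  gcongr
  calc _ ≤ 8 * C ^ 3 * ‖D₁‖ * (2 * C) + 2 * C ^ 2 * (2 * C ^ 2 * ‖D₂‖) := by
        gcongr
        · exact norm_segmentWeight_add_sub_le hη h₁ ht hC hD₁ hC1
        · exact norm_segmentInverse_add_le hη h₂ ht hC hD₂
        · exact norm_segmentWeight_le hη ht hC hC1
        · exact norm_segmentInverse_add_sub_le hη h₂ ht hC hD₂
    _ ≤ 16 * C ^ 4 * (‖D₁‖ + ‖D₂‖) := by
        nlinarith [mul_nonneg (by positivity : 0 ≤ C ^ 4) (norm_nonneg D₂)]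

theorem IsSpectralDecomposition.norm_relEntropy_sub_quadF_le (h : IsSpectralDecomposition η μ p)
    (hm : 0 < m) (hm1 : m ≤ 1) (hμ : ∀ i, m ≤ μ i) (htr : tr D₁ = tr D₂) (hD₁ : ‖D₁‖ ≤ m / 2)
    (hD₂ : ‖D₂‖ ≤ m / 2) :
    ‖relEntropy (η + D₁) (η + D₂) - quadF μ p (D₁ - D₂)‖ ≤
      Module.finrank ℂ H * (16 * m⁻¹ ^ 4 * (‖D₁‖ + ‖D₂‖) * ‖D₁ - D₂‖ ^ 2) := by
  have hlog₁ := h.hasLog_add hm hμ (hD₁.trans_lt (half_lt_self hm))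
  have hlog₂ := h.hasLog_add hm hμ (hD₂.trans_lt (half_lt_self hm))
  have hμ0 : ∀ i, 0 < μ i := fun i => hm.trans_le (hμ i)
  have hsmall : ∀ {D : H →L[ℂ] H}, ‖D‖ ≤ m / 2 → m⁻¹ * ‖D‖ ≤ 1 / 2 := fun hD => by
    rw [inv_mul_le_iff₀ hm]
    linarith
  have htr' : tr (η + D₁) = tr (η + D₂) := by
    simp only [← trCLM_apply, map_add]
    exact congrArg _ htr
  have hcont : ∀ W V : ℝ → H →L[ℂ] H, ContinuousOn W (Icc 0 1) → ContinuousOn V (Icc 0 1) →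
      IntervalIntegrable (fun t => tr (W t * (D₁ - D₂) * (V t * (D₁ - D₂))))
        MeasureTheory.volume 0 1 := fun W V hW hV => by
    rw [← uIcc_of_le zero_le_one] at hW hV
    exact (continuousOn_tr ((hW.mul continuousOn_const).mul
      (hV.mul continuousOn_const))).intervalIntegrable
  have hη := h.spectrum_subset_slitPlane hμ0
  rw [relEntropy_eq_integral hlog₁ hlog₂ htr', h.quadF_eq_integral hμ0, add_sub_add_left_eq_sub,
    ← intervalIntegral.integral_sub
      (hcont _ _ (continuousOn_segmentWeight hlog₁.spectrum_subset_slitPlane)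
        (continuousOn_segmentInverse hlog₂.spectrum_subset_slitPlane))
      (hcont _ _ (continuousOn_segmentWeight hη) (continuousOn_segmentInverse hη))]
  refine (intervalIntegral.norm_integral_le_of_norm_le_const fun t ht => ?_).trans_eq
    (by rw [sub_zero, abs_one, mul_one])
  rw [uIoc_of_le zero_le_one] at ht
  have ht' := Ioc_subset_Icc_self ht
  exact norm_tr_segmentWeight_mul_sub_le hη hlog₁.spectrum_subset_slitPlane
    hlog₂.spectrum_subset_slitPlane ht' (h.norm_segmentInverse_le hm hm1 hμ ht')
    ((one_le_inv₀ hm).mpr hm1) (hsmall hD₁) (hsmall hD₂) _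

end RelEntropyEstimate

section FaithfulState

variable {η : H →L[ℂ] H}

theorem finrank_mul_le_constC (hpos : 0 < infSp η) (hle : infSp η ≤ 1) (D₁ D₂ : H →L[ℂ] H) :
    Module.finrank ℂ H * (16 * (infSp η)⁻¹ ^ 4 * (‖D₁‖ + ‖D₂‖) * ‖D₁ - D₂‖ ^ 2) ≤
      constC 24 η * (‖D₁‖ + ‖D₂‖) ^ 3 := by
  have hlog : 16 ≤ 24 * (Real.log 2 - Real.log (infSp η)) := by
    linarith [Real.log_two_gt_d9, Real.log_nonpos hpos.le hle]
  calc _ ≤ Module.finrank ℂ H * (24 * (Real.log 2 - Real.log (infSp η)) * (infSp η)⁻¹ ^ 4 *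
        (‖D₁‖ + ‖D₂‖) * (‖D₁‖ + ‖D₂‖) ^ 2) := by
        gcongr
        exact norm_sub_le _ _
    _ = constC 24 η * (‖D₁‖ + ‖D₂‖) ^ 3 := by rw [constC]; ring

theorem IsFaithfulState.pos_of_hasEigenvalue [CompleteSpace H] (h : IsFaithfulState η) {x : ℝ}
    (hx : Module.End.HasEigenvalue (η : H →ₗ[ℂ] H) (x : ℂ)) : 0 < x := by
  obtain ⟨v, hv⟩ := hx.exists_hasEigenvector
  have hinner : (inner ℂ v (η v)).re = x * ‖v‖ ^ 2 := by
    rw [show η v = (x : ℂ) • v from hv.apply_eq_smul, inner_smul_right, inner_self_eq_norm_sq_to_K]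
    simp [← Complex.ofReal_pow]
  exact pos_of_mul_pos_left (hinner ▸ h.posDef v hv.2) (sq_nonneg _)

variable [FiniteDimensional ℂ H]

theorem mem_spectrum_real_iff_hasEigenvalue {x : ℝ} :
    x ∈ spectrum ℝ η ↔ Module.End.HasEigenvalue (η : H →ₗ[ℂ] H) (x : ℂ) := by
  rw [Module.End.hasEigenvalue_iff_mem_spectrum, ← spectrum.algebraMap_mem_iff ℂ,
    ← AlgEquiv.spectrum_eq (Module.End.toContinuousLinearMap (𝕜 := ℂ) H) (η : H →ₗ[ℂ] H)]
  rfl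

theorem constC_pos [Nontrivial H] {c : ℝ} (hc : 0 < c) (hpos : 0 < infSp η)
    (hlt : infSp η < 2) : 0 < constC c η := by
  have hdim : (0 : ℝ) < Module.finrank ℂ H := Nat.cast_pos.mpr Module.finrank_pos
  have hlog : 0 < Real.log 2 - Real.log (infSp η) := sub_pos.mpr (Real.log_lt_log hpos hlt)
  rw [constC]
  positivity

variable [CompleteSpace H]

namespace IsFaithfulState

theorem nontrivial (h : IsFaithfulState η) : Nontrivial H := by
  by_contra! _
  have htrace := h.trace_one
  rw [Subsingleton.elim η 0, ← trCLM_apply, map_zero] at htrace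
  exact zero_ne_one htrace

theorem le_one_of_hasEigenvalue (h : IsFaithfulState η) {x : ℝ}
    (hx : Module.End.HasEigenvalue (η : H →ₗ[ℂ] H) (x : ℂ)) : x ≤ 1 := by
  have hsymm : (η : H →ₗ[ℂ] H).IsSymmetric := h.selfAdjoint.isSymmetric
  obtain ⟨i, hi⟩ := hsymm.exists_eigenvalues_eq rfl hx
  have hsum : ∑ j, hsymm.eigenvalues rfl j = 1 := by
    have htrace := (hsymm.trace_eq_sum_eigenvalues rfl).symm.trans h.trace_one
    exact RCLike.ofReal_injective (K := ℂ) (by simpa using htrace)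
  rw [← RCLike.ofReal_injective (K := ℂ) hi, ← hsum]
  exact Finset.single_le_sum (f := hsymm.eigenvalues rfl)
    (fun j _ => (h.pos_of_hasEigenvalue (hsymm.hasEigenvalue_eigenvalues rfl j)).le)
    (Finset.mem_univ i)

theorem hasEigenvalue_infSp (h : IsFaithfulState η) :
    Module.End.HasEigenvalue (η : H →ₗ[ℂ] H) (infSp η : ℂ) := by
  have := h.nontrivial
  have hsymm : (η : H →ₗ[ℂ] H).IsSymmetric := h.selfAdjoint.isSymmetric
  rw [← mem_spectrum_real_iff_hasEigenvalue]
  exact (spectrum.isCompact η).sInf_mem ⟨_, mem_spectrum_real_iff_hasEigenvalue.mpr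
    (hsymm.hasEigenvalue_eigenvalues rfl ⟨0, Module.finrank_pos⟩)⟩

theorem infSp_pos (h : IsFaithfulState η) : 0 < infSp η :=
  h.pos_of_hasEigenvalue h.hasEigenvalue_infSp

theorem infSp_le_one (h : IsFaithfulState η) : infSp η ≤ 1 :=
  h.le_one_of_hasEigenvalue h.hasEigenvalue_infSp

end IsFaithfulState

theorem proposition5p1_general (hpos : 0 < infSp η) (hle : infSp η ≤ 1) {n : ℕ} {μ : Fin n → ℝ}
    {p : Fin n → H →L[ℂ] H} (h : IsSpectralDecomposition η μ p) {D₁ D₂ : H →L[ℂ] H}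
    (htr : tr D₁ = tr D₂) (hD₁ : ‖D₁‖ ≤ infSp η / 2) (hD₂ : ‖D₂‖ ≤ infSp η / 2) :
    HasLog (η + D₁) ∧ HasLog (η + D₂) ∧
      ‖relEntropy (η + D₁) (η + D₂) - quadF μ p (D₁ - D₂)‖ ≤
        constC 24 η * (‖D₁‖ + ‖D₂‖) ^ 3 := by
  have hμ : ∀ i, infSp η ≤ μ i := fun i =>
    csInf_le (spectrum.isCompact η).bddBelow (h.mem_spectrum i)
  exact ⟨h.hasLog_add hpos hμ (hD₁.trans_lt (half_lt_self hpos)),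
    h.hasLog_add hpos hμ (hD₂.trans_lt (half_lt_self hpos)),
    (h.norm_relEntropy_sub_quadF_le hpos hle hμ htr hD₁ hD₂).trans
      (finrank_mul_le_constC hpos hle D₁ D₂)⟩

end FaithfulState

end EntropyPerturbation

end

open EntropyPerturbation in
theorem proposition5p1 :
    ∃ c : ℝ, 0 < c ∧
      ∀ (H : Type*) [NormedAddCommGroup H] [InnerProductSpace ℂ H] [CompleteSpace H]
        [FiniteDimensional ℂ H] (η : H →L[ℂ] H), IsFaithfulState η →
        0 < constC c η ∧
        ∃ Dη : ℝ, 0 < Dη ∧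
          ∀ (n : ℕ) (μ : Fin n → ℝ) (p : Fin n → H →L[ℂ] H), IsSpectralDecomposition η μ p →
          ∀ D₁ D₂ : H →L[ℂ] H, tr D₁ = 0 → tr D₂ = 0 → ‖D₁‖ ≤ Dη → ‖D₂‖ ≤ Dη →
            HasLog (η + D₁) ∧ HasLog (η + D₂) ∧
            ‖relEntropy (η + D₁) (η + D₂) - quadF μ p (D₁ - D₂)‖ ≤
              constC c η * (‖D₁‖ + ‖D₂‖) ^ 3 := by
  refine ⟨24, by norm_num, fun H _ _ _ _ η hη =>
    have := hη.nontrivial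
    ⟨constC_pos (by norm_num) hη.infSp_pos (hη.infSp_le_one.trans_lt one_lt_two),
      infSp η / 2, half_pos hη.infSp_pos, fun n μ p h D₁ D₂ h₁ h₂ hD₁ hD₂ =>
        proposition5p1_general hη.infSp_pos hη.infSp_le_one h (h₁.trans h₂.symm) hD₁ hD₂⟩⟩
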